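/- Let $S$ be a separable, right reversible semitopological semigroup: $S$ is a semigroup with a separable Hausdorff topology for which the maps $s\mapsto ts$ and $s\mapsto st$ are continuous for each fixed $t\in S$, and any two closed left ideals of $S$ intersect. Here a left ideal of $S$ is a nonempty set $I\subseteq S$ with $SI\subseteq I$; it is supported by $t\in S$ if $I\subseteq St$. Let $E$ be a (real or complex) Hausdorff locally convex space whose topology is determined by a family $Q$ of seminorms, and let $K\subseteq E$ be a nonempty weakly compact convex set. Let $S\times K\to K$, $(s,x)\mapsto s.x$, be an action, i.e. $(st).x=s.(t.x)$ for all $s,t\in S$, $x\in K$. Assume that the action is 1. separately weakly continuous: for each $s\in S$ the map $x\mapsto s.x$ is continuous from $K$ to $K$, and for each $x\in K$ the map $s\mapsto s.x$ is continuous from $S$ to $K$, where $K$ carries the relative weak topology of $E$; 2. $Q$-super asymptotically nonexpansive: for all $x\in K$, $t\in S$ and $q\in Q$ there is a left ideal $I$ of $S$ supported by $t$ such that $q(s.x-s.y)\le q(x-y)$ for all $s\in I$ and all $y\in K$; 3. $Q$-distal: for any two distinct points $x,y\in K$, the origin $0$ does not belong to the closure of $\{s.x-s.y : s\in S\}$ in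 the topology of $E$ determined by $Q$. Then the action has a common fixed point: there is $x_0\in K$ with $s.x_0=x_0$ for all $s\in S$. -/

import Mathlib

open scoped Topology

namespace SemitopAction

section Semigroups

variable {S : Type*} [Semigroup S]

/-- A left ideal of a semigroup `S`: a nonempty set `I` with `S I ⊆ I`. -/
def IsLeftIdeal (I : Set S) : Prop :=
  I.Nonempty ∧ ∀ s : S, ∀ i ∈ I, s * i ∈ I

/-- A subset `I` of `S` is supported by `t` if `I ⊆ S t`. -/
def IsSupportedBy (I : Set S) (t : S) : Prop :=
  I ⊆ Set.range (fun s : S => s * t)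

/-- `S` is right reversible if any two closed left ideals of `S` intersect. -/
def IsRightReversible (S : Type*) [Semigroup S] [TopologicalSpace S] : Prop :=
  ∀ I J : Set S, IsLeftIdeal I → IsClosed I → IsLeftIdeal J → IsClosed J → (I ∩ J).Nonempty

end Semigroups

section Actions

variable (S : Type*) [Semigroup S]

/-- The relative weak topology `σ(E, E')` on a subset `K` of `E`. -/
noncomputable abbrev weakTopologyOn (𝕜 : Type*) {E : Type*} [RCLike 𝕜] [AddCommGroup E] [Module 𝕜 E]
    [TopologicalSpace E] [IsTopologicalAddGroup E] [ContinuousSMul 𝕜 E] (K : Set E) :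
    TopologicalSpace K :=
  TopologicalSpace.induced (fun x : K => toWeakSpace 𝕜 E (x : E)) inferInstance

/-- The action `(s, x) ↦ s • x` of `S` on `K ⊆ E` is separately continuous for the relative weak
topology of `K`. -/
def SeparatelyWeaklyContinuous [tS : TopologicalSpace S] (𝕜 : Type*) {E : Type*} [RCLike 𝕜]
    [AddCommGroup E] [Module 𝕜 E] [TopologicalSpace E] [IsTopologicalAddGroup E]
    [ContinuousSMul 𝕜 E] (K : Set E) [SemigroupAction S K] : Prop :=
  (∀ s : S, Continuous[weakTopologyOn 𝕜 K, weakTopologyOn 𝕜 K] (fun x : K => s • x)) ∧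
    ∀ x : K, Continuous[tS, weakTopologyOn 𝕜 K] (fun s : S => s • x)

/-- `Q`-super asymptotic nonexpansiveness: for all `x ∈ K`, `t ∈ S` and all seminorms `q` of the
family `Q` there is a left ideal `I` supported by `t` such that `q (s x - s y) ≤ q (x - y)` for all
`s ∈ I` and `y ∈ K`. -/
def IsSuperAsymptoticallyNonexpansive {𝕜 E ι : Type*} [RCLike 𝕜] [AddCommGroup E] [Module 𝕜 E]
    (Q : SeminormFamily 𝕜 E ι) (K : Set E) [SemigroupAction S K] : Prop :=
  ∀ (x : K) (t : S) (i : ι), ∃ I : Set S, IsLeftIdeal I ∧ IsSupportedBy I t ∧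
    ∀ s ∈ I, ∀ y : K, Q i (((s • x : K) : E) - ((s • y : K) : E)) ≤ Q i ((x : E) - (y : E))

/-- Distality of the action for the topology of `E`: for distinct `x, y ∈ K`, the origin is not in
the closure of `{s x - s y : s ∈ S}`. -/
def IsDistalAction {E : Type*} [AddCommGroup E] [TopologicalSpace E] (K : Set E)
    [SemigroupAction S K] : Prop :=
  ∀ x y : K, x ≠ y →
    (0 : E) ∉ closure (Set.range (fun s : S => ((s • x : K) : E) - ((s • y : K) : E)))

end Actions

end SemitopAction

open Set

namespace SemitopAction

/-! Single translations need not be nonexpansive, but their limits along all closed left ideals are: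
each estimate holds on a left ideal, and seminorms are weakly lower semicontinuous. Right
reversibility and compactness make the set of such limits nonempty, and Zorn gives a minimal closed
`S`-invariant subset `L` of it (`exists_isMinimalEnvelopingIdeal`). Let `Y` be the orbit of a point
`x` under `L`. Separability and Baire's theorem yield weakly open pieces of `Y` of small seminorm
diameter (`exists_isOpen_small_diam`). With distality and minimality they force every `p ∈ L` to be
bijective on `Y`, and `Y` to be totally bounded for each seminorm (`orbit_structure`). Now choose
`x` in a minimal weakly closed convex `L`-invariant set `C`. By DeMarr's averaging argument,
positive diameter of `Y` would allow `C` to be shrunk (`seminorm_sub_eq_zero_of_minimal`). So `Y` is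
one point, which `S` fixes. -/

/-- Every nonempty closed set satisfying a property stable under intersections contains a minimal
one, in a compact space. -/
theorem exists_minimal_isClosed {X : Type*} [TopologicalSpace X] [CompactSpace X]
    (P : Set X → Prop) (hP : ∀ c : Set (Set X), c.Nonempty → (∀ s ∈ c, P s) → P (⋂₀ c))
    {C₀ : Set X} (hne : C₀.Nonempty) (hcl : IsClosed C₀) (h₀ : P C₀) :
    ∃ C ⊆ C₀, Minimal (fun C : Set X => C.Nonempty ∧ IsClosed C ∧ P C) C := by
  refine zorn_superset_nonempty {C : Set X | C.Nonempty ∧ IsClosed C ∧ P C} ?_ C₀ ⟨hne, hcl, h₀⟩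
  intro c hc hchain hcne
  have : Nonempty c := hcne.to_subtype
  refine ⟨⋂₀ c, ⟨?_, isClosed_sInter fun s hs => (hc hs).2.1,
    hP c hcne fun s hs => (hc hs).2.2⟩, fun s hs => sInter_subset_of_mem hs⟩
  exact IsCompact.nonempty_sInter_of_directed_nonempty_isCompact_isClosed
    (fun s hs t ht => (hchain.total hs ht).elim (fun h => ⟨s, hs, Subset.rfl, h⟩)
      fun h => ⟨t, ht, h, Subset.rfl⟩) (fun s hs => (hc hs).1) (fun s hs => (hc hs).2.1.isCompact)
    (fun s hs => (hc hs).2.1)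

section LeftIdeals

variable {S : Type*} [Semigroup S]

theorem isLeftIdeal_univ [Nonempty S] : IsLeftIdeal (univ : Set S) :=
  ⟨univ_nonempty, fun _ _ _ => mem_univ _⟩

variable [TopologicalSpace S]

theorem IsLeftIdeal.closure [SeparatelyContinuousMul S] {I : Set S} (hI : IsLeftIdeal I) :
    IsLeftIdeal (closure I) :=
  ⟨hI.1.closure, fun s _ hi => map_mem_closure
    (SeparatelyContinuousMul.continuous_const_mul (a := s)) hi fun j hj => hI.2 s j hj⟩

theorem IsRightReversible.isLeftIdeal_inter (hS : IsRightReversible S) {I J : Set S}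
    (hI : IsLeftIdeal I) (hIc : IsClosed I) (hJ : IsLeftIdeal J) (hJc : IsClosed J) :
    IsLeftIdeal (I ∩ J) :=
  ⟨hS I J hI hIc hJ hJc, fun s i hi => ⟨hI.2 s i hi.1, hJ.2 s i hi.2⟩⟩

end LeftIdeals

/-! ### Enveloping semigroups, minimal ideals and distality. -/

section Ellis

variable (S X : Type*) [Semigroup S] [SemigroupAction S X] [TopologicalSpace X]

/-- The pointwise limits of translations along every closed left ideal of `S`. -/
def closedIdealLimits [TopologicalSpace S] : Set (X → X) :=
  ⋂₀ ((fun I : Set S => closure ((fun (s : S) (x : X) => s • x) '' I)) ''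
    {I | IsLeftIdeal I ∧ IsClosed I})

/-- A minimal closed left ideal of the enveloping semigroup of an action. -/
structure IsMinimalEnvelopingIdeal (L : Set (X → X)) : Prop where
  nonempty : L.Nonempty
  isClosed : IsClosed L
  subset_closure : L ⊆ closure (range fun (s : S) (x : X) => s • x)
  smul_comp_mem : ∀ s : S, ∀ p ∈ L, (fun x => s • p x) ∈ L
  exists_comp_eq : ∀ p ∈ L, ∀ u ∈ L, ∃ g ∈ L, g ∘ p = u

variable {S X}

theorem comp_mem_of_mem_closure {A : Set (X → X)} (hA : IsClosed A)
    (hinv : ∀ s : S, ∀ p ∈ A, (fun x => s • p x) ∈ A) {g : X → X}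
    (hg : g ∈ closure (range fun (s : S) (x : X) => s • x)) {p : X → X} (hp : p ∈ A) :
    g ∘ p ∈ A := by
  have hc : Continuous fun g : X → X => g ∘ p := continuous_pi fun x => continuous_apply (p x)
  have hsub : (range fun (s : S) (x : X) => s • x) ⊆ (fun g : X → X => g ∘ p) ⁻¹' A :=
    range_subset_iff.2 fun s => hinv s p hp
  exact closure_minimal hsub (hA.preimage hc) hg

theorem IsMinimalEnvelopingIdeal.comp_mem {L : Set (X → X)} (hL : IsMinimalEnvelopingIdeal S X L)
    {g p : X → X} (hg : g ∈ L) (hp : p ∈ L) : g ∘ p ∈ L :=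
  comp_mem_of_mem_closure hL.isClosed hL.smul_comp_mem (hL.subset_closure hg) hp

/-- Ellis–Numakura: `L` is a compact semigroup under composition, and `g ↦ g ∘ p` is continuous. -/
theorem IsMinimalEnvelopingIdeal.exists_idempotent [CompactSpace X] [T2Space X]
    {L : Set (X → X)} (hL : IsMinimalEnvelopingIdeal S X L) : ∃ e ∈ L, e ∘ e = e := by
  let : Semigroup (X → X) := { mul := fun f g => f ∘ g, mul_assoc := fun _ _ _ => rfl }
  exact exists_idempotent_in_compact_subsemigroup
    (fun p => continuous_pi fun x => continuous_apply (p x)) L hL.nonempty hL.isClosed.isCompact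
    fun f hf g hg => hL.comp_mem hf hg

/-- The orbit of a point under a minimal ideal is minimal: every point has a dense orbit. -/
theorem IsMinimalEnvelopingIdeal.subset_closure_orbit {L : Set (X → X)}
    (hL : IsMinimalEnvelopingIdeal S X L) (x : X) {y z : X} (hy : y ∈ (fun p => p x) '' L)
    (hz : z ∈ (fun p => p x) '' L) : z ∈ closure (range fun s : S => s • y) := by
  obtain ⟨p, hp, rfl⟩ := hy
  obtain ⟨u, hu, rfl⟩ := hz
  obtain ⟨g, hg, rfl⟩ := hL.exists_comp_eq p hp u hu
  refine map_mem_closure (f := fun g : X → X => g (p x)) (continuous_apply (p x)) (hL.subset_closure hg) ?_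
  rintro _ ⟨s, rfl⟩
  exact ⟨s, rfl⟩

/-- The action on the orbit of a point under a minimal ideal of nonexpansive maps, for a distal
action with small open sets. -/
theorem IsMinimalEnvelopingIdeal.orbit_structure [CompactSpace X] [T2Space X]
    (hs : ∀ s : S, Continuous fun x : X => s • x) {ι : Type*} {d : ι → X → X → ℝ}
    {L : Set (X → X)} (hL : IsMinimalEnvelopingIdeal S X L)
    (hnonexp : ∀ p ∈ L, ∀ i x y, d i (p x) (p y) ≤ d i x y)
    (hdistal : ∀ x y : X, x ≠ y → ∃ i, ∃ δ > 0, ∀ s : S, δ ≤ d i (s • x) (s • y)) (x : X)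
    (hfrag : ∀ i, ∀ ε > 0, ∃ V : Set X, IsOpen V ∧ (V ∩ (fun p => p x) '' L).Nonempty ∧
      ∀ a ∈ V ∩ (fun p => p x) '' L, ∀ b ∈ V ∩ (fun p => p x) '' L, d i a b ≤ ε) :
    (∀ p ∈ L, ∀ y ∈ (fun p => p x) '' L, ∃ z ∈ (fun p => p x) '' L, p z = y) ∧
      ∀ i, ∀ ε > 0, ∃ t : Set X, t.Finite ∧ t ⊆ (fun p => p x) '' L ∧
        ∀ y ∈ (fun p => p x) '' L, ∃ z ∈ t, d i y z ≤ ε := by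
  set Y : Set X := (fun p => p x) '' L with hY
  have hmaps : ∀ p ∈ L, ∀ y ∈ Y, p y ∈ Y := by
    rintro p hp _ ⟨u, hu, rfl⟩
    exact ⟨p ∘ u, hL.comp_mem hp hu, rfl⟩
  have hsmul : ∀ s : S, ∀ y ∈ Y, s • y ∈ Y := by
    rintro s _ ⟨u, hu, rfl⟩
    exact ⟨_, hL.smul_comp_mem s u hu, rfl⟩
  have hhit : ∀ V : Set X, IsOpen V → (V ∩ Y).Nonempty → ∀ y ∈ Y, ∃ s : S, s • y ∈ V := by
    rintro V hV ⟨v, hv, hvY⟩ y hy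
    obtain ⟨_, hwV, s, rfl⟩ := mem_closure_iff.1 (hL.subset_closure_orbit x hy hvY) V hV hv
    exact ⟨s, hwV⟩
  have hinj : ∀ p ∈ L, ∀ z ∈ Y, ∀ w ∈ Y, p z = p w → z = w := by
    intro p hp z hz w hw hpq
    by_contra hne
    obtain ⟨i, δ, hδ, hle⟩ := hdistal z w hne
    obtain ⟨V, hV, hVY, hVd⟩ := hfrag i (δ / 2) (half_pos hδ)
    obtain ⟨s, hsV⟩ := hhit V hV hVY (p z) (hmaps p hp z hz)
    -- Since `p z = p w`, the map `s • p` sends both `z` and `w` into `V`. Some translation `s'`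
    -- near it does so too, against the lower bound `δ`.
    have hopen : IsOpen {g : X → X | g z ∈ V ∧ g w ∈ V} :=
      (hV.preimage (continuous_apply z)).inter (hV.preimage (continuous_apply w))
    have hsp := hL.subset_closure (hL.smul_comp_mem s p hp)
    obtain ⟨_, ⟨h1, h2⟩, s', rfl⟩ := mem_closure_iff.1 hsp _ hopen ⟨hsV, by
      change s • p w ∈ V
      rwa [← hpq]⟩
    have := hVd _ ⟨h1, hsmul s' z hz⟩ _ ⟨h2, hsmul s' w hw⟩
    have := hle s'
    linarith
  obtain ⟨e, he, hee⟩ := hL.exists_idempotent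
  -- Injectivity cancels one `e` in `e (e y) = e y`, so `e` is the identity on `Y`.
  have heY : ∀ y ∈ Y, e y = y := fun y hy =>
    hinj e he _ (hmaps e he y hy) y hy (congrFun hee y)
  refine ⟨fun p hp y hy => ?_, fun i ε hε => ?_⟩
  · obtain ⟨g, hg, hgp⟩ := hL.exists_comp_eq p hp e he
    refine ⟨g y, hmaps g hg y hy, hinj g hg _ (hmaps p hp _ (hmaps g hg y hy)) y hy ?_⟩
    exact (congrFun hgp (g y)).trans (heY _ (hmaps g hg y hy))
  · obtain ⟨V, hV, hVY, hVd⟩ := hfrag i ε hε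
    have hYc : IsCompact Y := hL.isClosed.isCompact.image (continuous_apply x)
    obtain ⟨t, ht⟩ := hYc.elim_finite_subcover (fun s : S => (fun y : X => s • y) ⁻¹' V)
      (fun s => hV.preimage (hs s)) fun y hy => mem_iUnion.2 (hhit V hV hVY y hy)
    -- As `e` is the identity on `Y`, `g s` is a nonexpansive left inverse of translation by `s` on
    -- `Y`; it carries the smallness of `V` back to the sets of the finite cover.
    choose g hg hge using fun s : S => hL.exists_comp_eq _ (hL.smul_comp_mem s e he) e he
    obtain ⟨v, hv⟩ := hVY
    refine ⟨(fun s => g s v) '' (t : Set S), t.finite_toSet.image _, ?_, fun y hy => ?_⟩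
    · rintro _ ⟨s, -, rfl⟩
      exact hmaps _ (hg s) v hv.2
    · obtain ⟨s, hst, hsy⟩ := mem_iUnion₂.1 (ht hy)
      refine ⟨g s v, mem_image_of_mem _ hst, ?_⟩
      have hgy : g s (s • y) = y := by
        have := congrFun (hge s) y
        simpa only [Function.comp_apply, heY y hy] using this
      calc d i y (g s v) = d i (g s (s • y)) (g s v) := by rw [hgy]
        _ ≤ d i (s • y) v := hnonexp _ (hg s) _ _ _
        _ ≤ ε := hVd _ ⟨hsy, hsmul s y hy⟩ v hv

/-! ### Limits of translations along closed left ideals. -/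

variable [TopologicalSpace S]

theorem isClosed_closedIdealLimits : IsClosed (closedIdealLimits S X) := by
  refine isClosed_sInter ?_
  rintro _ ⟨I, -, rfl⟩
  exact isClosed_closure

theorem mem_closedIdealLimits {p : X → X} : p ∈ closedIdealLimits S X ↔
    ∀ I : Set S, IsLeftIdeal I → IsClosed I →
      p ∈ closure ((fun (s : S) (x : X) => s • x) '' I) := by
  simp [closedIdealLimits]

/-- Right reversibility makes the closed left ideals downward directed, so the compact closures have
a common point. -/
theorem nonempty_closedIdealLimits [CompactSpace X] [T2Space X] [Nonempty S]
    (hS : IsRightReversible S) : (closedIdealLimits S X).Nonempty := by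
  have : Nonempty ((fun I : Set S => closure ((fun (s : S) (x : X) => s • x) '' I)) ''
      {I | IsLeftIdeal I ∧ IsClosed I}) :=
    ⟨⟨_, univ, ⟨isLeftIdeal_univ, isClosed_univ⟩, rfl⟩⟩
  refine IsCompact.nonempty_sInter_of_directed_nonempty_isCompact_isClosed ?_ ?_ ?_ ?_
  · rintro _ ⟨I, ⟨hI, hIc⟩, rfl⟩ _ ⟨J, ⟨hJ, hJc⟩, rfl⟩
    exact ⟨_, ⟨I ∩ J, ⟨hS.isLeftIdeal_inter hI hIc hJ hJc, hIc.inter hJc⟩, rfl⟩,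
      closure_mono (image_mono inter_subset_left), closure_mono (image_mono inter_subset_right)⟩
  · rintro _ ⟨I, ⟨hI, -⟩, rfl⟩
    exact (hI.1.image _).closure
  · rintro _ ⟨I, -, rfl⟩
    exact isClosed_closure.isCompact
  · rintro _ ⟨I, -, rfl⟩
    exact isClosed_closure

theorem smul_comp_mem_closedIdealLimits (hs : ∀ s : S, Continuous fun x : X => s • x) (s : S)
    {p : X → X} (hp : p ∈ closedIdealLimits S X) :
    (fun x => s • p x) ∈ closedIdealLimits S X := by
  rw [mem_closedIdealLimits] at hp ⊢
  intro I hI hIc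
  have hc : Continuous fun (p : X → X) (x : X) => s • p x :=
    continuous_pi fun x => (hs s).comp (continuous_apply x)
  refine map_mem_closure hc (hp I hI hIc) ?_
  rintro _ ⟨i, hi, rfl⟩
  exact ⟨s * i, hI.2 s i hi, funext fun x => mul_smul s i x⟩

/-- For `p ∈ L` the set `L ∘ p` is again nonempty, closed, invariant and inside `L`, so minimality
gives `L ∘ p = L`. -/
theorem exists_isMinimalEnvelopingIdeal [CompactSpace X] [T2Space X] [Nonempty S]
    (hS : IsRightReversible S) (hs : ∀ s : S, Continuous fun x : X => s • x) :
    ∃ L ⊆ closedIdealLimits S X, IsMinimalEnvelopingIdeal S X L := by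
  obtain ⟨L, hL, ⟨hne, hcl, hinv⟩, hmin⟩ := exists_minimal_isClosed
    (fun A : Set (X → X) => ∀ s : S, ∀ p ∈ A, (fun x => s • p x) ∈ A)
    (fun c _ hc s p hp A hA => hc A hA s p (hp A hA)) (nonempty_closedIdealLimits (X := X) hS)
    isClosed_closedIdealLimits fun s p hp => smul_comp_mem_closedIdealLimits hs s hp
  have hsub : L ⊆ closure (range fun (s : S) (x : X) => s • x) := fun p hp => by
    simpa only [image_univ] using
      mem_closedIdealLimits.1 (hL hp) univ isLeftIdeal_univ isClosed_univ
  refine ⟨L, hL, hne, hcl, hsub, hinv, fun p hp u hu => ?_⟩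
  have hc : Continuous fun g : X → X => g ∘ p := continuous_pi fun x => continuous_apply (p x)
  refine hmin (y := (fun g : X → X => g ∘ p) '' L) ⟨hne.image _,
    (hcl.isCompact.image hc).isClosed, ?_⟩ ?_ hu
  · rintro s _ ⟨g, hg, rfl⟩
    exact ⟨_, hinv s g hg, rfl⟩
  · rintro _ ⟨g, hg, rfl⟩
    exact comp_mem_of_mem_closure hcl hinv (hsub hg) hp

/-- A limit of translations along all closed left ideals inherits the estimates which hold on some
left ideal. -/
theorem le_of_mem_closedIdealLimits [SeparatelyContinuousMul S]
    (hx : ∀ x : X, Continuous fun s : S => s • x) {d : X → X → ℝ}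
    (hd : ∀ r, IsClosed {z : X × X | d z.1 z.2 ≤ r}) {p : X → X}
    (hp : p ∈ closedIdealLimits S X) {x y : X} {I : Set S} (hI : IsLeftIdeal I) {r : ℝ}
    (hle : ∀ s ∈ I, d (s • x) (s • y) ≤ r) : d (p x) (p y) ≤ r := by
  have h1 : IsClosed {g : X → X | d (g x) (g y) ≤ r} :=
    (hd r).preimage (f := fun g : X → X => (g x, g y))
      ((continuous_apply x).prodMk (continuous_apply y))
  have h2 : IsClosed {s : S | d (s • x) (s • y) ≤ r} :=
    (hd r).preimage (f := fun s : S => (s • x, s • y)) ((hx x).prodMk (hx y))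
  -- The estimate is a closed condition both on `s` and on the limit map: it passes from `I` to the
  -- closed left ideal `closure I`, then to `p`.
  refine closure_minimal ?_ h1 (mem_closedIdealLimits.1 hp _ hI.closure isClosed_closure)
  rintro _ ⟨s, hs, rfl⟩
  exact closure_minimal (fun s hs => hle s hs) h2 hs

end Ellis

/-! ### Weak topology, small open sets and DeMarr's argument. -/

section LocallyConvex

variable {𝕜 E : Type*} [RCLike 𝕜] [AddCommGroup E] [Module 𝕜 E] [Module ℝ E]
  [IsScalarTower ℝ 𝕜 E]

/-- DeMarr's lemma: a set with a finite net has a point in any convex set around it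
whose radius is strictly smaller than the diameter. -/
theorem exists_radius_lt_diam {q : Seminorm 𝕜 E} {C Y t : Set E} (hC : Convex ℝ C) (hYC : Y ⊆ C)
    (hne : Y.Nonempty) {D : ℝ} (hD : 0 < D) (hdiam : ∀ x ∈ Y, ∀ y ∈ Y, q (x - y) ≤ D)
    (ht : t.Finite) (htY : t ⊆ Y) (hnet : ∀ y ∈ Y, ∃ z ∈ t, q (y - z) ≤ D / 2) :
    ∃ u ∈ C, ∃ r < D, ∀ y ∈ Y, q (u - y) ≤ r := by
  classical
  lift t to Finset E using ht
  have htne : t.Nonempty := by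
    obtain ⟨y, hy⟩ := hne
    obtain ⟨z, hz, -⟩ := hnet y hy
    exact ⟨z, hz⟩
  have hn : (0 : ℝ) < t.card := by exact_mod_cast htne.card_pos
  set w : ℝ := (t.card : ℝ)⁻¹ with hw
  have hw0 : 0 < w := inv_pos.2 hn
  have hsum : ∑ _z ∈ t, w = 1 := by
    rw [Finset.sum_const, nsmul_eq_mul, hw, mul_inv_cancel₀ hn.ne']
  refine ⟨∑ z ∈ t, w • z, hC.sum_mem (fun _ _ => hw0.le) hsum fun z hz => hYC (htY hz),
    -- In the average of the net, one point is within `D / 2` of `y` and the others within `D`.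
    D - w * (D / 2), by nlinarith, fun y hy => ?_⟩
  obtain ⟨z₀, hz₀, hz₀y⟩ := hnet y hy
  have hu : (∑ z ∈ t, w • z) - y = ∑ z ∈ t, w • (z - y) := by
    simp only [smul_sub, Finset.sum_sub_distrib]
    rw [← Finset.sum_smul, hsum, one_smul]
  calc q ((∑ z ∈ t, w • z) - y) = q (∑ z ∈ t, w • (z - y)) := by rw [hu]
    _ ≤ ∑ z ∈ t, w • q (z - y) :=
        q.convexOn.map_sum_le (fun _ _ => hw0.le) hsum fun _ _ => mem_univ _
    _ ≤ ∑ z ∈ t, (w * D - if z = z₀ then w * (D / 2) else 0) := by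
        refine Finset.sum_le_sum fun z hz => ?_
        rw [smul_eq_mul]
        split_ifs with h
        · subst h
          rw [map_sub_rev] at hz₀y
          nlinarith
        · have := hdiam z (htY hz) y hy
          nlinarith
    _ = D - w * (D / 2) := by
        rw [Finset.sum_sub_distrib, ← Finset.sum_mul, hsum, Finset.sum_ite_eq' t z₀,
          if_pos (Finset.mem_coe.1 hz₀), one_mul]

theorem convex_image_sInter {X : Type*} {f : X → E} (hinj : Function.Injective f)
    {c : Set (Set X)} (hne : c.Nonempty) (hc : ∀ s ∈ c, Convex ℝ (f '' s)) :
    Convex ℝ (f '' ⋂₀ c) := by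
  rw [sInter_eq_biInter, hinj.injOn.image_biInter_eq hne]
  exact convex_iInter₂ hc

variable [TopologicalSpace E] [IsTopologicalAddGroup E] [ContinuousSMul 𝕜 E]

/-- Mazur's theorem; it is the source of the weak lower semicontinuity of seminorms below. -/
theorem isClosed_toWeakSpace_image [LocallyConvexSpace ℝ E] {s : Set E} (hs : Convex ℝ s)
    (hcl : IsClosed s) : IsClosed (toWeakSpace 𝕜 E '' s) := by
  rw [← closure_eq_iff_isClosed, ← hs.toWeakSpace_closure 𝕜, hcl.closure_eq]

theorem isClosed_weak_seminorm_le [LocallyConvexSpace ℝ E] {q : Seminorm 𝕜 E}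
    (hq : Continuous q) (r : ℝ) :
    IsClosed {w : WeakSpace 𝕜 E | q ((toWeakSpace 𝕜 E).symm w) ≤ r} := by
  have hcl : IsClosed (q.closedBall 0 r) := by
    rw [q.closedBall_zero_eq]
    exact isClosed_le hq continuous_const
  convert isClosed_toWeakSpace_image (𝕜 := 𝕜) (q.convex_closedBall 0 r) hcl using 1
  rw [LinearEquiv.image_eq_preimage_symm, q.closedBall_zero_eq]
  rfl

theorem isClosed_seminorm_sub_le [LocallyConvexSpace ℝ E] {X : Type*} [TopologicalSpace X]
    {f g : X → E} (hf : Continuous fun x => toWeakSpace 𝕜 E (f x))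
    (hg : Continuous fun x => toWeakSpace 𝕜 E (g x))
    {q : Seminorm 𝕜 E} (hq : Continuous q) (r : ℝ) :
    IsClosed {x | q (f x - g x) ≤ r} := by
  have h := (isClosed_weak_seminorm_le hq r).preimage (hf.sub hg)
  have heq : {x | q (f x - g x) ≤ r} = ((fun x => toWeakSpace 𝕜 E (f x)) -
      fun x => toWeakSpace 𝕜 E (g x)) ⁻¹' {w | q ((toWeakSpace 𝕜 E).symm w) ≤ r} := by
    ext x
    simp only [mem_preimage, mem_ofPred_eq, Pi.sub_apply, map_sub, LinearEquiv.symm_apply_apply]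
  rwa [heq]

/-- A weakly compact set which is weakly separable has nonempty relatively weakly open subsets of
small diameter for every continuous seminorm. -/
theorem exists_isOpen_small_diam [LocallyConvexSpace ℝ E] {X : Type*} [TopologicalSpace X]
    [CompactSpace X] [T2Space X] {f : X → E} (hf : Continuous fun x => toWeakSpace 𝕜 E (f x))
    {Y D : Set X} (hY : IsClosed Y) (hne : Y.Nonempty) (hD : D.Countable) (hYD : Y ⊆ closure D)
    {q : Seminorm 𝕜 E} (hq : Continuous q) {ε : ℝ} (hε : 0 < ε) :
    ∃ V : Set X, IsOpen V ∧ (V ∩ Y).Nonempty ∧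
      ∀ a ∈ V ∩ Y, ∀ b ∈ V ∩ Y, q (f a - f b) ≤ ε := by
  -- The closed span of `f '' D` is separable in the original topology and, being convex, weakly
  -- closed; hence it contains `f '' Y`.
  obtain ⟨c, hc, hWc⟩ := ((hD.image f).isSeparable.span (R := 𝕜)).closure
  have hconv : Convex ℝ (closure (Submodule.span 𝕜 (f '' D) : Set E)) := by
    have h := ((Submodule.span 𝕜 (f '' D)).restrictScalars ℝ).convex
    have : ContinuousConstSMul ℝ E :=
      ⟨fun r => by
      simpa only [algebraMap_smul] using continuous_const_smul (T := E) (algebraMap ℝ 𝕜 r)⟩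
    exact h.closure
  have hYW : ∀ y ∈ Y, f y ∈ closure (Submodule.span 𝕜 (f '' D) : Set E) := by
    intro y hy
    have hcl := (isClosed_toWeakSpace_image (𝕜 := 𝕜) hconv isClosed_closure).preimage hf
    have hsub : D ⊆ (fun x => toWeakSpace 𝕜 E (f x)) ⁻¹'
        (toWeakSpace 𝕜 E '' closure (Submodule.span 𝕜 (f '' D) : Set E)) := fun x hx =>
      mem_image_of_mem _ (subset_closure (Submodule.subset_span (mem_image_of_mem f hx)))
    exact ((toWeakSpace 𝕜 E).injective.mem_set_image).1 (closure_minimal hsub hcl (hYD hy))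
  have : Countable c := hc.to_subtype
  have : CompactSpace Y := isCompact_iff_compactSpace.1 hY.isCompact
  have : Nonempty Y := hne.to_subtype
  -- Baire in the compact Hausdorff space `Y`: countably many weakly closed seminorm balls cover it.
  obtain ⟨z, hz⟩ := nonempty_interior_of_iUnion_of_closed
    (f := fun z : c => {y : Y | q (f y - z) ≤ ε / 2})
    (fun z => isClosed_seminorm_sub_le (hf.comp continuous_subtype_val) continuous_const hq _) (by
      refine eq_univ_of_forall fun y => mem_iUnion.2 ?_
      have hopen : IsOpen {v : E | q (f y - v) < ε / 2} :=
        isOpen_lt (hq.comp (continuous_const.sub continuous_id)) continuous_const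
      obtain ⟨z, hz, hzc⟩ := mem_closure_iff.1 (hWc (hYW y y.2)) _ hopen (by simpa using hε)
      have hlt : q (f y - z) < ε / 2 := hz
      exact ⟨⟨z, hzc⟩, hlt.le⟩)
  obtain ⟨V, hV, hVi⟩ := isOpen_induced_iff.1 (isOpen_interior (s := {y : Y | q (f y - z) ≤ ε / 2}))
  have hle : ∀ a ∈ V ∩ Y, q (f a - z) ≤ ε / 2 := fun a ha => by
    have : (⟨a, ha.2⟩ : Y) ∈ interior {y : Y | q (f y - z) ≤ ε / 2} := by
      rw [← hVi]
      exact ha.1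
    have h := interior_subset this
    exact h
  refine ⟨V, hV, ?_, fun a ha b hb => ?_⟩
  · obtain ⟨y, hy⟩ := hz
    rw [← hVi] at hy
    exact ⟨y, hy, y.2⟩
  · calc q (f a - f b) = q ((f a - z) - (f b - z)) := by congr 1; abel
      _ ≤ q (f a - z) + q (f b - z) := map_sub_le_add q _ _
      _ ≤ ε := by linarith [hle a ha, hle b hb]

/-- A convex set invariant under a family of nonexpansive maps, minimal among the weakly closed
ones, contains no nontrivial set with finite nets on which these maps are onto. -/
theorem seminorm_sub_eq_zero_of_minimal [LocallyConvexSpace ℝ E] {X : Type*} [TopologicalSpace X]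
    {f : X → E} (hf : Continuous fun x => toWeakSpace 𝕜 E (f x)) {L : Set (X → X)} {C : Set X}
    (hC : Minimal (fun C : Set X => C.Nonempty ∧ IsClosed C ∧
      (Convex ℝ (f '' C) ∧ ∀ p ∈ L, MapsTo p C C)) C)
    {q : Seminorm 𝕜 E} (hq : Continuous q)
    (hnonexp : ∀ p ∈ L, ∀ x y, q (f (p x) - f (p y)) ≤ q (f x - f y))
    {Y : Set X} (hYC : Y ⊆ C) (hsurj : ∀ p ∈ L, ∀ y ∈ Y, ∃ z ∈ Y, p z = y)
    (hnet : ∀ ε > 0, ∃ t : Set X, t.Finite ∧ t ⊆ Y ∧ ∀ y ∈ Y, ∃ z ∈ t, q (f y - f z) ≤ ε)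
    {a b : X} (ha : a ∈ Y) (hb : b ∈ Y) : q (f a - f b) = 0 := by
  obtain ⟨⟨-, hCcl, hCconv, hCL⟩, hmin⟩ := hC
  by_contra hab
  have htri : ∀ u v w : E, q (u - w) ≤ q (u - v) + q (v - w) := fun u v w => by
    simpa using map_add_le_add q (u - v) (v - w)
  set T : Set ℝ := (fun z : X × X => q (f z.1 - f z.2)) '' (Y ×ˢ Y) with hT
  have hbdd : BddAbove T := by
    obtain ⟨t, ht, -, hyt⟩ := hnet 1 one_pos
    obtain ⟨M, hM⟩ := ((ht.prod ht).image fun z : X × X => q (f z.1 - f z.2)).bddAbove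
    refine ⟨1 + M + 1, ?_⟩
    rintro _ ⟨⟨x, y⟩, ⟨hx, hy⟩, rfl⟩
    obtain ⟨x', hx', hxx⟩ := hyt x hx
    obtain ⟨y', hy', hyy⟩ := hyt y hy
    rw [map_sub_rev] at hyy
    have h3 : q (f x' - f y') ≤ M := hM ⟨(x', y'), ⟨hx', hy'⟩, rfl⟩
    have h1 := htri (f x) (f x') (f y)
    have h2 := htri (f x') (f y') (f y)
    dsimp only
    linarith
  have hmem : q (f a - f b) ∈ T := ⟨(a, b), ⟨ha, hb⟩, rfl⟩
  have hlub := isLUB_csSup ⟨_, hmem⟩ hbdd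
  set D := sSup T
  have hD : 0 < D := ((apply_nonneg q _).lt_of_ne' hab).trans_le (hlub.1 hmem)
  obtain ⟨t, ht, htY, hyt⟩ := hnet (D / 2) (half_pos hD)
  obtain ⟨_, ⟨u, hu, rfl⟩, r, hr, hur⟩ := exists_radius_lt_diam (q := q) (Y := f '' Y) (t := f '' t)
    hCconv (image_mono hYC) ⟨_, mem_image_of_mem f ha⟩ hD (by
      rintro _ ⟨x, hx, rfl⟩ _ ⟨y, hy, rfl⟩
      exact hlub.1 ⟨(x, y), ⟨hx, hy⟩, rfl⟩) (ht.image f) (image_mono htY) (by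
      rintro _ ⟨y, hy, rfl⟩
      obtain ⟨z, hz, hyz⟩ := hyt y hy
      exact ⟨f z, mem_image_of_mem f hz, hyz⟩)
  -- The points of `C` within `r` of all of `Y` form an admissible set: since each `p ∈ L` maps onto
  -- `Y`, nonexpansiveness gives invariance. Minimality then makes it all of `C`, so `Y` has
  -- diameter at most `r < D`.
  have hCsub : C ⊆ C ∩ ⋂ y ∈ Y, {z | q (f z - f y) ≤ r} := by
    refine hmin ⟨⟨u, hu, mem_iInter₂.2 fun y hy => hur _ (mem_image_of_mem f hy)⟩,
      hCcl.inter (isClosed_biInter fun y _ => isClosed_seminorm_sub_le hf continuous_const hq r),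
      ?_, fun p hp z hz => ⟨hCL p hp hz.1, mem_iInter₂.2 fun y hy => ?_⟩⟩ inter_subset_left
    · have : f '' (C ∩ ⋂ y ∈ Y, {z | q (f z - f y) ≤ r}) =
          f '' C ∩ ⋂ y ∈ Y, q.closedBall (f y) r := by
        ext v
        constructor
        · rintro ⟨z, ⟨hz, hzY⟩, rfl⟩
          refine ⟨mem_image_of_mem f hz, mem_iInter₂.2 fun y hy => ?_⟩
          exact (q.mem_closedBall).2 (mem_iInter₂.1 hzY y hy)
        · rintro ⟨⟨z, hz, rfl⟩, hzY⟩
          refine ⟨z, ⟨hz, mem_iInter₂.2 fun y hy => ?_⟩, rfl⟩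
          exact (q.mem_closedBall).1 (mem_iInter₂.1 hzY y hy)
      rw [this]
      exact hCconv.inter (convex_iInter₂ fun y _ => q.convex_closedBall _ _)
    · obtain ⟨y', hy', rfl⟩ := hsurj p hp y hy
      exact (hnonexp p hp z y').trans (mem_iInter₂.1 hz.2 y' hy')
  have hDr : D ≤ r := by
    refine hlub.2 ?_
    rintro _ ⟨⟨x, y⟩, ⟨hx, hy⟩, rfl⟩
    exact mem_iInter₂.1 (hCsub (hYC hx)).2 y hy
  linarith

/-! ### Assembly of the fixed point theorem. -/

variable {S : Type*} [Semigroup S] [TopologicalSpace S] [SeparatelyContinuousMul S]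
  [TopologicalSpace.SeparableSpace S] {X : Type*} [TopologicalSpace X] [CompactSpace X]
  [SemigroupAction S X]

/-- The fixed point theorem for a compact convex set given by an injective map which is
continuous for the weak topology. -/
theorem exists_fixed_point_of_injective [T2Space E] (hS : IsRightReversible S) {ι : Type*}
    {Q : SeminormFamily 𝕜 E ι} (hQ : WithSeminorms Q) [Nonempty X] {f : X → E}
    (hinj : Function.Injective f) (hconv : Convex ℝ (range f))
    (hf : Continuous fun x => toWeakSpace 𝕜 E (f x))
    (hs : ∀ s : S, Continuous fun x : X => s • x) (hx : ∀ x : X, Continuous fun s : S => s • x)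
    (hnonexp : ∀ (x : X) (t : S) (i : ι), ∃ I : Set S, IsLeftIdeal I ∧ IsSupportedBy I t ∧
      ∀ s ∈ I, ∀ y : X, Q i (f (s • x) - f (s • y)) ≤ Q i (f x - f y))
    (hdistal : ∀ x y : X, x ≠ y →
      (0 : E) ∉ closure (range fun s : S => f (s • x) - f (s • y))) :
    ∃ x : X, ∀ s : S, s • x = x := by
  rcases isEmpty_or_nonempty S with hempty | ⟨⟨s₀⟩⟩
  · exact ⟨Classical.arbitrary X, fun s => (hempty.false s).elim⟩
  have : Nonempty S := ⟨s₀⟩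
  have : LocallyConvexSpace ℝ E := hQ.toLocallyConvexSpace
  have hQc : ∀ F : Finset ι, Continuous (F.sup Q : Seminorm 𝕜 E) := fun F => by
    refine Seminorm.continuous (r := 1) ?_
    have := hQ.hasBasis_zero_ball.mem_of_mem (i := (F, 1)) one_pos
    exact this
  have hsep : ∀ {u v : E}, (∀ F : Finset ι, (F.sup Q) (u - v) = 0) → u = v := fun {u v} h => by
    by_contra huv
    obtain ⟨i, hi⟩ := hQ.separating_of_T1 _ (sub_ne_zero.2 huv)
    exact hi (by simpa using h {i})
  have hd : ∀ F : Finset ι, ∀ r, IsClosed {z : X × X | (F.sup Q) (f z.1 - f z.2) ≤ r} :=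
    fun F r => isClosed_seminorm_sub_le (hf.comp continuous_fst) (hf.comp continuous_snd) (hQc F) r
  have hdiag : diagonal X = ⋂ F : Finset ι, {z : X × X | (F.sup Q) (f z.1 - f z.2) ≤ 0} := by
    ext ⟨x, y⟩
    simp only [mem_diagonal_iff, mem_iInter, mem_ofPred_eq]
    refine ⟨fun h F => by simp [h], fun h => hinj (hsep fun F => ?_)⟩
    exact le_antisymm (h F) (apply_nonneg _ _)
  have : T2Space X := t2_iff_isClosed_diagonal.2 (hdiag ▸ isClosed_iInter fun F => hd F 0)
  obtain ⟨L, hLlim, hL⟩ := exists_isMinimalEnvelopingIdeal (S := S) hS hs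
  have hLnonexp : ∀ p ∈ L, ∀ F : Finset ι, ∀ x y,
      (F.sup Q) (f (p x) - f (p y)) ≤ (F.sup Q) (f x - f y) := by
    intro p hp F x y
    refine Seminorm.finset_sup_apply_le (apply_nonneg _ _) fun i hi => ?_
    obtain ⟨I, hI, -, hle⟩ := hnonexp x s₀ i
    refine (le_of_mem_closedIdealLimits hx (d := fun x y => Q i (f x - f y)) (fun r => ?_)
      (hLlim hp) hI fun s hs => hle s hs y).trans (Seminorm.le_finset_sup_apply hi)
    simpa using hd {i} r
  -- A neighbourhood of `0` contains a ball of a finite supremum of seminorms, which is why such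
  -- suprema replace single members of `Q`.
  have hdistal' : ∀ x y : X, x ≠ y → ∃ F : Finset ι, ∃ δ > 0, ∀ s : S,
      δ ≤ (F.sup Q) (f (s • x) - f (s • y)) := by
    intro x y hxy
    obtain ⟨F, δ, hδ, hsub⟩ := (hQ.mem_nhds_iff 0 _).1
      (isClosed_closure.isOpen_compl.mem_nhds (hdistal x y hxy))
    refine ⟨F, δ, hδ, fun s => not_lt.1 fun hlt => hsub ?_ (subset_closure ⟨s, rfl⟩)⟩
    exact (Seminorm.mem_ball_zero _).2 hlt
  -- Invariance is asked under `L`, not `S`, because DeMarr's argument needs nonexpansive maps.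
  obtain ⟨C, -, hCmin⟩ := exists_minimal_isClosed
    (fun C : Set X => Convex ℝ (f '' C) ∧ ∀ p ∈ L, MapsTo p C C)
    (fun c hne hc => ⟨convex_image_sInter hinj hne fun s hs => (hc s hs).1,
      fun p hp x hx s hs => (hc s hs).2 p hp (hx s hs)⟩) univ_nonempty isClosed_univ
    ⟨by rwa [image_univ], fun p _ => mapsTo_univ p _⟩
  obtain ⟨x, hxC⟩ := hCmin.1.1
  have hYC : (fun p : X → X => p x) '' L ⊆ C := by
    rintro _ ⟨p, hp, rfl⟩
    exact hCmin.1.2.2.2 p hp hxC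
  obtain ⟨p, hp⟩ := hL.nonempty
  have hpY : p x ∈ (fun p : X → X => p x) '' L := mem_image_of_mem _ hp
  have hfrag : ∀ F : Finset ι, ∀ ε > 0, ∃ V : Set X, IsOpen V ∧
      (V ∩ (fun p => p x) '' L).Nonempty ∧ ∀ a ∈ V ∩ (fun p => p x) '' L,
        ∀ b ∈ V ∩ (fun p => p x) '' L, (F.sup Q) (f a - f b) ≤ ε := by
    intro F ε hε
    obtain ⟨D, hD, hDd⟩ := TopologicalSpace.exists_countable_dense S
    refine exists_isOpen_small_diam hf
      (hL.isClosed.isCompact.image (continuous_apply x)).isClosed ⟨_, hpY⟩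
      -- Separability of `S` enters here: a countable part of the orbit of `p x` is dense in `Y`.
      (hD.image fun s => s • p x) (fun z hz => ?_) (hQc F) hε
    exact closure_minimal ((hx (p x)).range_subset_closure_image_dense hDd) isClosed_closure
      (hL.subset_closure_orbit x hpY hz)
  obtain ⟨hsurj, hnet⟩ := hL.orbit_structure hs
    (d := fun (F : Finset ι) x y => (F.sup Q) (f x - f y)) hLnonexp hdistal' x hfrag
  refine ⟨p x, fun s => hinj (hsep fun F => ?_)⟩
  -- Both `s • p x` and `p x` lie in `Y`, as `L` is invariant under translations.
  exact seminorm_sub_eq_zero_of_minimal hf hCmin (hQc F)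
    (fun p hp => hLnonexp p hp F) hYC hsurj (hnet F) ⟨_, hL.smul_comp_mem s p hp, rfl⟩ hpY

end LocallyConvex

end SemitopAction

theorem mainTheorem6
    {S : Type*} [Semigroup S] [TopologicalSpace S] [T2Space S] [SeparatelyContinuousMul S]
    [TopologicalSpace.SeparableSpace S] (hS : SemitopAction.IsRightReversible S)
    {𝕜 : Type*} [RCLike 𝕜] {E : Type*} [AddCommGroup E] [Module 𝕜 E] [Module ℝ E]
    [IsScalarTower ℝ 𝕜 E] [TopologicalSpace E] [IsTopologicalAddGroup E] [ContinuousSMul 𝕜 E]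
    [T2Space E] {ι : Type*} (Q : SeminormFamily 𝕜 E ι) (hQ : WithSeminorms Q)
    (K : Set E) (hK_nonempty : K.Nonempty) (hK_convex : Convex ℝ K)
    (hK_compact : IsCompact (toWeakSpace 𝕜 E '' K))
    [SemigroupAction S K]
    (h_cont : SemitopAction.SeparatelyWeaklyContinuous S 𝕜 K)
    (h_nonexp : SemitopAction.IsSuperAsymptoticallyNonexpansive S Q K)
    (h_distal : SemitopAction.IsDistalAction S K) :
    ∃ x : K, ∀ s : S, s • x = x := by
  have hne : Nonempty K := hK_nonempty.to_subtype
  let τ : TopologicalSpace K := SemitopAction.weakTopologyOn 𝕜 K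
  have hind : Topology.IsInducing fun x : K => toWeakSpace 𝕜 E (x : E) := ⟨rfl⟩
  have hcomp : CompactSpace K := by
    refine ⟨hind.isCompact_iff.2 ?_⟩
    convert hK_compact using 1
    ext w
    simp
  exact SemitopAction.exists_fixed_point_of_injective hS hQ (f := fun x : K => (x : E))
    Subtype.val_injective (by rwa [Subtype.range_coe]) hind.continuous h_cont.1 h_cont.2
    h_nonexp h_distal
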